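/- An ideal on a set $X$ is a family $\mathcal I\subseteq\mathcal P(X)$ with $\emptyset\in\mathcal I$, $X\notin\mathcal I$, closed under subsets and under unions of two members; $Y\subseteq X$ is $\mathcal I$-positive if $Y\notin\mathcal I$, and then $\mathcal I\upharpoonright Y=\mathcal P(Y)\cap\mathcal I$. For ideals $\mathcal J$ on $Y$ and $\mathcal I$ on $X$, write $\mathcal J\le_K\mathcal I$ (Katětov order) if there is $f:X\to Y$ with $f^{-1}(A)\in\mathcal I$ for all $A\in\mathcal J$. For a topological space $X$, $\mathsf{nwd}(X)$ is the family of nowhere dense subsets of $X$; $\mathsf{nwd}=\mathsf{nwd}(\mathbb Q)$. $\mathcal{ED}$ is the ideal on $\omega\times\omega$ generated by the columns $\{n\}\times\omega$ and the graphs of functions $\omega\to\omega$. An ideal $\mathcal I$ on a countable set satisfies the Category Dichotomy if $\mathcal I\le_K\mathsf{nwd}$ or there is an $\mathcal I$-positive $Y$ with $\mathcal{ED}\le_K\mathcal I\upharpoonright Y$. The bounding number $\mathfrak b$ is the least size of a subfamily of $\omega^\omega$ that is unbounded with respect to $\le^*$. A family $\mathcal B$ of non-empty open sets of $X$ is a $\pi$-base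 if every non-empty open set contains a member of $\mathcal B$, and a local $\pi$-base at $x$ if every neighbourhood of $x$ contains a member of $\mathcal B$; the $\pi$-weight of $X$ and the $\pi$-character of $x$ are the least sizes of such families. **Theorem.** (In ZFC.) There is a topology $\tau_{\mathbb D}$ on $\omega^{<\omega}$ such that the countable space $\mathbb D=(\omega^{<\omega},\tau_{\mathbb D})$ is Hausdorff, Fréchet (whenever $a\in\overline Y$, some sequence of points of $Y$ converges to $a$), zero dimensional (it has a base of clopen sets), has $\pi$-weight at least $\mathfrak b$, has uncountable $\pi$-character at every point, and such that $\mathsf{nwd}(\mathbb D)$ is an ideal that fails the Category Dichotomy: $\mathsf{nwd}(\mathbb D)\not\le_K\mathsf{nwd}$, and $\mathcal{ED}\not\le_K\mathsf{nwd}(\mathbb D)\upharpoonright Y$ for every $\mathsf{nwd}(\mathbb D)$-positive set $Y$. Consequently, transporting $\mathsf{nwd}(\mathbb D)$ along any bijection $\omega^{<\omega}\to\omega$ gives an ideal on $\omega$ that fails the Category Dichotomy. -/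

import Mathlib

open Set Topology Cardinal

/-! ### Ideals on a set

An ideal on `X` is a proper order ideal of the lattice `Set X`, i.e. a term `I : Order.Ideal (Set X)`
with `I.IsProper`. -/

/-- The order ideal of `Set X` with the given membership predicate. -/
def Order.Ideal.ofPred {X : Type*} (p : Set X → Prop) (h0 : p ∅)
    (hmono : ∀ A B : Set X, A ⊆ B → p B → p A) (hunion : ∀ A B : Set X, p A → p B → p (A ∪ B)) :
    Order.Ideal (Set X) where
  carrier := {A | p A}
  lower' := fun A B hBA hA => hmono B A hBA hA
  nonempty' := ⟨∅, h0⟩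
  directed' := fun A hA B hB => ⟨A ∪ B, hunion A B hA hB, subset_union_left, subset_union_right⟩

/-- The ideal generated by a family `G` of subsets of `X`: the sets covered by finitely many
members of `G`. -/
def generatedIdeal {X : Type*} (G : Set (Set X)) : Order.Ideal (Set X) :=
  Order.Ideal.ofPred (fun A => ∃ F : Set (Set X), F.Finite ∧ F ⊆ G ∧ A ⊆ ⋃₀ F)
    ⟨∅, finite_empty, empty_subset _, empty_subset _⟩
    (fun _ _ hAB ⟨F, hF, hFG, hB⟩ => ⟨F, hF, hFG, hAB.trans hB⟩)
    (fun _ _ ⟨F, hF, hFG, hA⟩ ⟨F', hF', hFG', hB⟩ =>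
      ⟨F ∪ F', hF.union hF', union_subset hFG hFG', by
        rw [sUnion_union]; exact union_subset_union hA hB⟩)

/-- The restriction `I ↾ Y`, the members of `I` that are subsets of `Y`, as an ideal on `Y`. -/
def restrictIdeal {X : Type*} (I : Order.Ideal (Set X)) (Y : Set X) : Order.Ideal (Set Y) :=
  Order.Ideal.ofPred (fun B => ((↑) : Y → X) '' B ∈ I)
    (by rw [image_empty]; exact I.bot_mem)
    (fun _ _ hAB hB => I.lower (image_mono hAB) hB)
    (fun _ _ hA hB => by rw [image_union]; exact Order.Ideal.sup_mem hA hB)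

/-- The image of an ideal under a map; for a bijection, the copy of the ideal on the target. -/
def pushIdeal {X Y : Type*} (f : X → Y) (I : Order.Ideal (Set X)) : Order.Ideal (Set Y) :=
  Order.Ideal.ofPred (fun A => f ⁻¹' A ∈ I)
    (by rw [preimage_empty]; exact I.bot_mem)
    (fun _ _ hAB hB => I.lower (preimage_mono hAB) hB)
    (fun _ _ hA hB => by rw [preimage_union]; exact Order.Ideal.sup_mem hA hB)

/-- `nwd(X)`: the nowhere dense subsets of a topological space. -/
def nwdIdeal (X : Type*) [TopologicalSpace X] : Order.Ideal (Set X) :=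
  Order.Ideal.ofPred (fun A => IsNowhereDense A)
    (by simp [IsNowhereDense])
    (fun _ _ hAB hB => subset_empty_iff.mp
      ((interior_mono (closure_mono hAB)).trans (subset_empty_iff.mpr hB)))
    (fun A B hA hB => by
      have hA' : interior (closure A) = ∅ := hA
      have hB' : interior (closure B) = ∅ := hB
      change interior (closure (A ∪ B)) = ∅
      rw [closure_union, interior_union_isClosed_of_interior_empty isClosed_closure hB', hA'])

/-- The ideal `ED` on `ω × ω`, generated by the columns and the graphs of functions. -/
def idealED : Order.Ideal (Set (ℕ × ℕ)) :=
  generatedIdeal ({C | ∃ n : ℕ, C = {p | p.1 = n}} ∪ {G | ∃ f : ℕ → ℕ, G = {p | p.2 = f p.1}})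

/-- The Katětov order `J ≤_K I`. -/
def KatetovLE {X Y : Type*} (J : Order.Ideal (Set Y)) (I : Order.Ideal (Set X)) : Prop :=
  ∃ f : X → Y, ∀ A : Set Y, A ∈ J → f ⁻¹' A ∈ I

/-- `I` satisfies the Category Dichotomy: `I ≤_K nwd(ℚ)`, or `ED ≤_K I ↾ Y` for some
`I`-positive set `Y`. -/
def CategoryDichotomy {X : Type*} (I : Order.Ideal (Set X)) : Prop :=
  KatetovLE I (nwdIdeal ℚ) ∨ ∃ Y : Set X, Y ∉ I ∧ KatetovLE idealED (restrictIdeal I Y)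

/-! ### Cardinal invariants -/

/-- The bounding number: the least size of a subfamily of `ω^ω` that is unbounded in the
order of eventual domination. -/
noncomputable def boundingNumber : Cardinal.{0} :=
  sInf {κ | ∃ B : Set (ℕ → ℕ),
    (¬ ∃ g : ℕ → ℕ, ∀ f ∈ B, {n | ¬ f n ≤ g n}.Finite) ∧ #B = κ}

/-- A `π`-base: a family of non-empty open sets such that every non-empty open set contains
a member of the family. -/
def IsPiBase {X : Type*} [TopologicalSpace X] (B : Set (Set X)) : Prop :=
  (∀ V ∈ B, IsOpen V ∧ V.Nonempty) ∧ ∀ U : Set X, IsOpen U → U.Nonempty → ∃ V ∈ B, V ⊆ U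

/-- A local `π`-base at `x`: a family of non-empty open sets such that every neighbourhood of `x`
contains a member of the family. -/
def IsLocalPiBase {X : Type*} [TopologicalSpace X] (x : X) (B : Set (Set X)) : Prop :=
  (∀ V ∈ B, IsOpen V ∧ V.Nonempty) ∧ ∀ U ∈ 𝓝 x, ∃ V ∈ B, V ⊆ U

/-- The `π`-weight of `X`. -/
noncomputable def piWeight (X : Type*) [TopologicalSpace X] : Cardinal :=
  sInf {κ | ∃ B : Set (Set X), IsPiBase B ∧ #B = κ}

/-- The `π`-character of `x`. -/
noncomputable def piCharacter {X : Type*} [TopologicalSpace X] (x : X) : Cardinal :=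
  sInf {κ | ∃ B : Set (Set X), IsLocalPiBase x B ∧ #B = κ}

/-- A base of clopen sets. -/
def IsZeroDimensional (X : Type*) [TopologicalSpace X] : Prop :=
  TopologicalSpace.IsTopologicalBasis {U : Set X | IsClopen U}

/-- The set `ω^{<ω}` of finite sequences of natural numbers. It is a separate definition so that no
topology on lists is picked up by instance search. -/
def FinSeq : Type := List ℕ

open Filter

/-! ### The bounding number -/

/-! Fix an unbounded family of monotone functions `f α`, of length 𝔟 and increasing modulo finite.
It decides which sequences converge in the tree: those that run through distinct successors of `a`
and, for each `α`, eventually do not follow `f α` above `a`. The points following `f α` above `t`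
then form a clopen set omitting `t`, while an open set contains almost all successors of each of its
points. For fewer than 𝔟 non-empty open sets, one `g` dominates the thresholds hidden in "almost
all"; an `f α` that exceeds `g` infinitely often is followed by some point of each of them. Hence
local π-bases have size at least 𝔟 (`boundingNumber_le_card_of_isLocalPiBase`).

The Fréchet property rests on `exists_conv_diagonal`: in a limit of limits, indices below a suitable
`δ` are handled by bounding fewer than 𝔟 functions, those from `δ` on by growth.

Both halves of the dichotomy then fail for general reasons. Without countable local π-bases, one
nowhere dense set meets countably many given somewhere dense sets, which rules out reductions to
`nwd`. In a countable Fréchet Hausdorff space without isolated points, a single partial graph can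
have somewhere dense preimage, which rules out `ED`. -/

theorem exists_dominating_of_lt_boundingNumber {ι : Type} (h : ι → ℕ → ℕ)
    (hι : #ι < boundingNumber) : ∃ g : ℕ → ℕ, ∀ i, ∀ᶠ n in atTop, h i n ≤ g n := by
  by_contra hne
  refine absurd hι (not_lt.mpr ?_)
  refine le_trans (csInf_le' ⟨range h, ?_, rfl⟩) mk_range_le
  rintro ⟨g, hg⟩
  refine hne ⟨g, fun i => ?_⟩
  rw [← Nat.cofinite_eq_atTop, eventually_cofinite]
  exact hg _ ⟨i, rfl⟩

theorem exists_unbounded_card_eq_boundingNumber :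
    ∃ B : Set (ℕ → ℕ), (¬ ∃ g : ℕ → ℕ, ∀ f ∈ B, ∀ᶠ n in atTop, f n ≤ g n) ∧
      #B = boundingNumber := by
  have hne : {κ | ∃ B : Set (ℕ → ℕ),
      (¬ ∃ g : ℕ → ℕ, ∀ f ∈ B, {n | ¬ f n ≤ g n}.Finite) ∧ #B = κ}.Nonempty := by
    refine ⟨_, univ, ?_, rfl⟩
    rintro ⟨g, hg⟩
    refine Set.infinite_univ (α := ℕ) ((hg (fun n => g n + 1) (mem_univ _)).subset ?_)
    intro n _
    simp
  obtain ⟨B, hB, hc⟩ := csInf_mem hne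
  refine ⟨B, ?_, hc⟩
  rintro ⟨g, hg⟩
  refine hB ⟨g, fun f hf => ?_⟩
  have := hg f hf
  rwa [← Nat.cofinite_eq_atTop, eventually_cofinite] at this

theorem aleph0_lt_boundingNumber : ℵ₀ < boundingNumber := by
  obtain ⟨B, hB, hc⟩ := exists_unbounded_card_eq_boundingNumber
  by_contra hlt
  rw [not_lt, ← hc, mk_le_aleph0_iff] at hlt
  refine hB ?_
  rcases isEmpty_or_nonempty B with hE | hN
  · exact ⟨0, fun f hf => (hE.false ⟨f, hf⟩).elim⟩
  obtain ⟨e, he⟩ := exists_surjective_nat B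
  refine ⟨fun n => ∑ i ∈ Finset.range (n + 1), (e i : ℕ → ℕ) n, fun f hf => ?_⟩
  obtain ⟨i, hi⟩ := he ⟨f, hf⟩
  filter_upwards [eventually_ge_atTop i] with n hn
  have := Finset.single_le_sum (f := fun i => (e i : ℕ → ℕ) n) (fun _ _ => Nat.zero_le _)
    (Finset.mem_range.mpr (Nat.lt_succ_of_le hn))
  simpa [hi] using this

/-! ### Unbounded scales -/

/-- A family of monotone functions, well-ordered by eventual domination and unbounded, such that
families indexed by proper initial segments are bounded. -/
structure IsUnboundedScale {I : Type} [LinearOrder I] (f : I → ℕ → ℕ) : Prop where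
  wf : WellFounded ((· < ·) : I → I → Prop)
  monotone : ∀ α, Monotone (f α)
  eventually_le : ∀ α β, α ≤ β → ∀ᶠ n in atTop, f α n ≤ f β n
  unbounded : ∀ g : ℕ → ℕ, ∃ α, ∃ᶠ n in atTop, g n < f α n
  bounded_Iio : ∀ (α : I) (h : I → ℕ → ℕ), ∃ g : ℕ → ℕ, ∀ β < α, ∀ᶠ n in atTop, h β n ≤ g n

/-- Recursion along 𝔟: each stage dominates the fewer than 𝔟 earlier functions and one member of an
unbounded family. Taking partial sums makes the result monotone. -/
theorem exists_isUnboundedScale :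
    ∃ (I : Type) (_ : LinearOrder I) (f : I → ℕ → ℕ), IsUnboundedScale f := by
  obtain ⟨B, hB, hc⟩ := exists_unbounded_card_eq_boundingNumber
  let I := boundingNumber.ord.ToType
  have hI : #I = #B := by rw [hc]; exact mk_ord_toType _
  obtain ⟨e⟩ := Cardinal.eq.mp hI
  have hsmall : ∀ α : I, #(Iio α) < boundingNumber := fun α => mk_Iio_toType_ord_lt α
  have hbd : ∀ (α : I) (h : Iio α → ℕ → ℕ), ∃ g : ℕ → ℕ, ∀ β, ∀ᶠ n in atTop, h β n ≤ g n :=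
    fun α h => exists_dominating_of_lt_boundingNumber h (hsmall α)
  choose G hG using hbd
  have hwf : WellFounded ((· < ·) : I → I → Prop) := wellFounded_lt
  let step : ∀ α : I, (∀ β : I, β < α → ℕ → ℕ) → ℕ → ℕ := fun α F n =>
    ∑ i ∈ Finset.range (n + 1), ((e α : ℕ → ℕ) i + G α (fun β => F β β.2) i)
  let f : I → ℕ → ℕ := hwf.fix step
  have hf : ∀ α n, f α n =
      ∑ i ∈ Finset.range (n + 1), ((e α : ℕ → ℕ) i + G α (fun β => f β) i) := by
    intro α n
    have := hwf.fix_eq step α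
    exact congrFun this n
  have hle : ∀ α n, (e α : ℕ → ℕ) n + G α (fun β => f β) n ≤ f α n := by
    intro α n
    rw [hf]
    exact Finset.single_le_sum (f := fun i => (e α : ℕ → ℕ) i + G α (fun β => f β) i)
      (fun _ _ => Nat.zero_le _) (Finset.self_mem_range_succ n)
  refine ⟨I, inferInstance, f, hwf, fun α m n hmn => ?_, fun α β hαβ => ?_, fun g => ?_,
    fun α h => ?_⟩
  · rw [hf, hf]
    exact Finset.sum_le_sum_of_subset (Finset.range_mono (by omega))
  · rcases hαβ.eq_or_lt with rfl | hlt
    · exact Eventually.of_forall fun _ => le_rfl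
    · filter_upwards [hG β (fun γ => f γ) ⟨α, hlt⟩] with n hn
      exact hn.trans ((Nat.le_add_left _ _).trans (hle β n))
  · by_contra hne
    push Not at hne
    refine hB ⟨g, fun b hb => ?_⟩
    filter_upwards [hne (e.symm ⟨b, hb⟩)] with n hn
    have h1 := hle (e.symm ⟨b, hb⟩) n
    rw [Equiv.apply_symm_apply] at h1
    exact (Nat.le_add_right _ _).trans (h1.trans hn)
  · exact ⟨G α (fun β => h β), fun β hβ => hG α (fun β => h β) ⟨β, hβ⟩⟩

namespace IsUnboundedScale

variable {I : Type} [LinearOrder I] {f : I → ℕ → ℕ}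

/-- Monotonicity is what makes the scale unbounded along every infinite subset: a bound at the
points `n k` extends to all `m` through the least `k` with `m ≤ n k`. -/
theorem exists_lt_comp (hf : IsUnboundedScale f) {n : ℕ → ℕ} (hn : StrictMono n) (g : ℕ → ℕ) :
    ∃ α, ∃ᶠ k in atTop, g k < f α (n k) := by
  by_contra hne
  push Not at hne
  have hex : ∀ m, ∃ k, m ≤ n k := fun m => ⟨m, hn.le_apply⟩
  obtain ⟨α, hα⟩ := hf.unbounded fun m => g (Nat.find (hex m))
  obtain ⟨K, hK⟩ := eventually_atTop.mp (hne α)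
  refine hα ?_
  filter_upwards [eventually_gt_atTop (n K)] with m hm
  rw [not_lt]
  have h1 := Nat.find_spec (hex m)
  refine (hf.monotone α h1).trans (hK _ ?_)
  exact (hn.lt_iff_lt.mp (hm.trans_le h1)).le

/-- A sequence without upper bound would be cofinal; as ℵ₀ < 𝔟, a single function would then
dominate the whole scale. -/
theorem exists_isLUB (hf : IsUnboundedScale f) (γ : ℕ → I) :
    ∃ δ, (∀ k, γ k ≤ δ) ∧ ∀ β < δ, ∃ k, β < γ k := by
  have hne : {δ | ∀ k, γ k ≤ δ}.Nonempty := by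
    by_contra hemp
    have hlt : ∀ δ, ∃ k, δ < γ k := by
      intro δ
      by_contra hδ
      push Not at hδ
      exact hemp ⟨δ, hδ⟩
    obtain ⟨g, hg⟩ := exists_dominating_of_lt_boundingNumber (fun k => f (γ k))
      (by rw [mk_nat]; exact aleph0_lt_boundingNumber)
    obtain ⟨α, hα⟩ := hf.unbounded g
    obtain ⟨k, hk⟩ := hlt α
    refine hα ?_
    filter_upwards [hf.eventually_le _ _ hk.le, hg k] with n h1 h2
    exact not_lt.mpr (h1.trans h2)
  refine ⟨hf.wf.min _ hne, hf.wf.min_mem _ hne, fun β hβ => ?_⟩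
  by_contra h
  push Not at h
  refine hf.wf.not_lt_min {δ | ∀ k, γ k ≤ δ} (x := β) ?_ hβ
  exact h

end IsUnboundedScale

/-! ### The tree of finite sequences -/

namespace FinSeq

/-- The extension of `x` by the entry `q`. -/
def cons (q : ℕ) (x : FinSeq) : FinSeq := List.cons q x

/-- Finite sequences are ordered by extension. -/
instance : PartialOrder FinSeq where
  le a b := List.IsSuffix a b
  le_refl a := List.suffix_refl a
  le_trans _ _ _ h h' := List.IsSuffix.trans h h'
  le_antisymm _ _ h h' := h.eq_of_length (le_antisymm h.length_le h'.length_le)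

instance : Countable FinSeq := inferInstanceAs (Countable (List ℕ))

instance : Nonempty FinSeq := inferInstanceAs (Nonempty (List ℕ))

theorem le_total_of_le {a b c : FinSeq} (ha : a ≤ c) (hb : b ≤ c) : a ≤ b ∨ b ≤ a :=
  List.suffix_or_suffix_of_suffix ha hb

theorem le_cons (q : ℕ) (x : FinSeq) : x ≤ cons q x := List.suffix_cons q x

theorem le_cons_iff {a x : FinSeq} {q : ℕ} : a ≤ cons q x ↔ a = cons q x ∨ a ≤ x :=
  List.suffix_cons_iff

theorem exists_cons_le {a b : FinSeq} (h : a < b) : ∃ q, cons q a ≤ b := by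
  obtain ⟨t, ht⟩ := (h.le : List.IsSuffix a b)
  rcases List.eq_nil_or_concat t with rfl | ⟨L, q, rfl⟩
  · exact absurd ht h.ne
  · exact ⟨q, L, by rw [← ht, List.concat_eq_append]; exact (List.append_assoc L [q] a).symm⟩

theorem cons_inj {q r : ℕ} {x y : FinSeq} : cons q x = cons r y ↔ q = r ∧ x = y :=
  List.cons_eq_cons

/-- The sum of the entries of a sequence, each increased by one. -/
def weight (x : FinSeq) : ℕ := List.sum x + List.length x

theorem weight_cons (q : ℕ) (x : FinSeq) : weight (cons q x) = q + 1 + weight x := by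
  have h (l : List ℕ) : (q :: l).sum + (q :: l).length = q + 1 + (l.sum + l.length) := by
    rw [List.sum_cons, List.length_cons]
    omega
  exact h x

theorem weight_mono : Monotone weight := by
  rintro a b ⟨t, rfl⟩
  have h (l m : List ℕ) : m.sum + m.length ≤ (l ++ m).sum + (l ++ m).length := by
    rw [List.sum_append, List.length_append]
    omega
  exact h t a

theorem cons_not_le (q : ℕ) (x : FinSeq) : ¬ cons q x ≤ x := fun h => by
  have := weight_mono h
  rw [weight_cons] at this
  omega

theorem eq_of_cons_le {q r : ℕ} {a c : FinSeq} (hq : cons q a ≤ c) (hr : cons r a ≤ c) : q = r := by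
  rcases le_total_of_le hq hr with h | h
  · rcases le_cons_iff.mp h with h | h
    · exact (cons_inj.mp h).1
    · exact absurd h (cons_not_le q a)
  · rcases le_cons_iff.mp h with h | h
    · exact (cons_inj.mp h).1.symm
    · exact absurd h (cons_not_le r a)

/-- Somewhere between `a` and `y` an entry is chosen according to `g`. -/
def Follows (g : ℕ → ℕ) (a y : FinSeq) : Prop :=
  ∃ x q, a ≤ x ∧ cons q x ≤ y ∧ q = g (weight x)

theorem Follows.mono {g : ℕ → ℕ} {a y z : FinSeq} (h : Follows g a y) (hyz : y ≤ z) :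
    Follows g a z := by
  obtain ⟨x, q, h1, h2, h3⟩ := h
  exact ⟨x, q, h1, h2.trans hyz, h3⟩

theorem not_follows_self (g : ℕ → ℕ) (a : FinSeq) : ¬ Follows g a a := by
  rintro ⟨x, q, h1, h2, -⟩
  exact cons_not_le q x (h2.trans h1)

/-- A step between `a` and `z` lies below or above any intermediate point. -/
theorem Follows.split {g : ℕ → ℕ} {a x z : FinSeq} (h : Follows g a z) (hxz : x ≤ z) :
    Follows g a x ∨ Follows g x z := by
  obtain ⟨y, q, h1, h2, h3⟩ := h
  rcases le_total_of_le hxz h2 with h | h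
  · rcases le_cons_iff.mp h with rfl | h
    · exact Or.inl ⟨y, q, h1, le_rfl, h3⟩
    · exact Or.inr ⟨y, q, h, h2, h3⟩
  · exact Or.inl ⟨y, q, h1, h, h3⟩

/-- A step at a later `x` has `n ≤ weight x`, so its entry would be at least `g n`, more than the
weight of `z` allows. -/
theorem not_follows_of_weight_lt {g : ℕ → ℕ} (hg : Monotone g) {a z : FinSeq} {n : ℕ}
    (hz : cons n a ≤ z) (hn : n ≠ g (weight a)) (hw : weight z < g n) : ¬ Follows g a z := by
  rintro ⟨x, q, h1, h2, h3⟩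
  rcases h1.eq_or_lt with rfl | h1
  · exact hn (eq_of_cons_le hz h2 ▸ h3)
  · obtain ⟨m, hm⟩ := exists_cons_le h1
    obtain rfl := eq_of_cons_le hz (hm.trans ((le_cons q x).trans h2))
    have hx := weight_mono hm
    have hq := weight_mono h2
    rw [weight_cons] at hx hq
    have := hg (show n ≤ weight x by omega)
    omega

/-! ### The topology -/

variable {I : Type} (f : I → ℕ → ℕ)

/-- The basic convergent sequences: they run through different immediate successors of the limit
and eventually avoid every member of the family `f`. -/
def Conv (s : ℕ → FinSeq) (a : FinSeq) : Prop :=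
  ∃ n : ℕ → ℕ, StrictMono n ∧ (∀ k, cons (n k) a ≤ s k) ∧
    ∀ α, ∀ᶠ k in atTop, ¬ Follows (f α) a (s k)

variable {f}

theorem Conv.comp {s : ℕ → FinSeq} {a : FinSeq} (h : Conv f s a) {φ : ℕ → ℕ} (hφ : StrictMono φ) :
    Conv f (s ∘ φ) a := by
  obtain ⟨n, hn, hs, hα⟩ := h
  exact ⟨n ∘ φ, hn.comp hφ, fun k => hs _, fun α => hφ.tendsto_atTop.eventually (hα α)⟩

theorem Conv.le {s : ℕ → FinSeq} {a : FinSeq} (h : Conv f s a) (k : ℕ) : a ≤ s k := by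
  obtain ⟨n, -, hs, -⟩ := h
  exact (le_cons _ _).trans (hs k)

theorem conv_cons (a : FinSeq) : Conv f (fun k => cons k a) a := by
  refine ⟨id, strictMono_id, fun k => le_rfl, fun α => ?_⟩
  filter_upwards [eventually_ne_atTop (f α (weight a))] with k hk
  rintro ⟨x, q, h1, h2, h3⟩
  rcases le_cons_iff.mp h2 with h | h
  · obtain ⟨rfl, rfl⟩ := cons_inj.mp h
    exact hk h3
  · exact cons_not_le q x (h.trans h1)

variable (f)

/-- The finest topology in which the basic convergent sequences converge. -/
@[reducible] def convTopology : TopologicalSpace FinSeq where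
  IsOpen U := ∀ a ∈ U, ∀ s, Conv f s a → ∀ᶠ k in atTop, s k ∈ U
  isOpen_univ _ _ _ _ := Eventually.of_forall fun _ => mem_univ _
  isOpen_inter _ _ hU hV a ha s hs := (hU a ha.1 s hs).and (hV a ha.2 s hs)
  isOpen_sUnion _ h a := by
    rintro ⟨U, hU, ha⟩ s hs
    filter_upwards [h U hU a ha s hs] with k hk
    exact ⟨U, hU, hk⟩

local notation "𝒯" => convTopology f

variable {f}

theorem isOpen_iff {U : Set FinSeq} :
    IsOpen[𝒯] U ↔ ∀ a ∈ U, ∀ s, Conv f s a → ∀ᶠ k in atTop, s k ∈ U := Iff.rfl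

theorem Conv.tendsto {s : ℕ → FinSeq} {a : FinSeq} (h : Conv f s a) :
    Tendsto s atTop (@nhds _ 𝒯 a) := by
  let := 𝒯
  intro U hU
  obtain ⟨V, hVU, hV, ha⟩ := mem_nhds_iff.mp hU
  filter_upwards [isOpen_iff.mp hV a ha s h] with k hk
  exact hVU hk

theorem isOpen_of_isUpperSet {U : Set FinSeq} (hU : IsUpperSet U) : IsOpen[𝒯] U :=
  isOpen_iff.mpr fun _ ha _ hs => Eventually.of_forall fun k => hU (hs.le k) ha

/-- For closedness: once `n k ≥ weight t`, the successor `cons (n k) a` is too heavy to lie below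
`t`. -/
theorem isClopen_Ici (t : FinSeq) : @IsClopen _ 𝒯 (Ici t) := by
  let := 𝒯
  refine ⟨⟨isOpen_iff.mpr fun a ha s hs => ?_⟩, isOpen_of_isUpperSet (isUpperSet_Ici t)⟩
  obtain ⟨n, hn, hs, -⟩ := hs
  filter_upwards [eventually_ge_atTop (weight t)] with k hk hts
  have hk' : weight t ≤ n k := hk.trans hn.le_apply
  rcases le_total_of_le (hs k) hts with h | h
  · have := weight_mono h
    rw [weight_cons] at this
    omega
  · rcases le_cons_iff.mp h with rfl | h
    · rw [weight_cons] at hk'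
      omega
    · exact ha h

theorem isClopen_follows (α : I) (t : FinSeq) : @IsClopen _ 𝒯 {y | Follows (f α) t y} := by
  let := 𝒯
  refine ⟨⟨isOpen_iff.mpr fun a ha s hs => ?_⟩,
    isOpen_of_isUpperSet fun y z hyz hy => Follows.mono hy hyz⟩
  have hle := hs.le
  obtain ⟨n, hn, hs, hα⟩ := hs
  filter_upwards [hα α] with k hk hF
  rcases Follows.split hF (hle k) with h | h
  · exact ha h
  · exact hk h

theorem exists_isClopen_subset {V : Set FinSeq} (hV : IsOpen[𝒯] V) {a : FinSeq} (ha : a ∈ V) :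
    ∃ U, @IsClopen _ 𝒯 U ∧ a ∈ U ∧ U ⊆ V := by
  let := 𝒯
  -- Removing everything above a bad point leaves those `y ≥ a` for which the whole interval from
  -- `a` to `y` lies in `V`.
  let C : Set FinSeq := {y | ∃ z, z ∉ V ∧ a ≤ z ∧ z ≤ y}
  have hC : IsOpen C := isOpen_of_isUpperSet fun y y' hyy' ⟨z, h1, h2, h3⟩ =>
    ⟨z, h1, h2, h3.trans hyy'⟩
  refine ⟨Ici a ∩ Cᶜ, ⟨(isClopen_Ici a).1.inter hC.isClosed_compl, ?_⟩, ⟨self_mem_Ici, ?_⟩, ?_⟩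
  · refine isOpen_iff.mpr fun x hx s hs => ?_
    by_contra hfr
    obtain ⟨φ, hφ, hφs⟩ := extraction_of_frequently_atTop (not_eventually.mp hfr)
    have hφC : ∀ k, ∃ z, z ∉ V ∧ a ≤ z ∧ z ≤ s (φ k) := by
      intro k
      by_contra hk
      exact hφs k ⟨le_trans hx.1 (hs.le _), hk⟩
    choose z hzV haz hzs using hφC
    obtain ⟨n, hn, hns, hα⟩ := hs.comp hφ
    have hzx : ∀ k, cons (n k) x ≤ z k := by
      intro k
      rcases le_total_of_le (hns k) (hzs k) with h | h
      · exact h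
      · rcases le_cons_iff.mp h with h | h
        · exact h.ge
        · exact absurd ⟨z k, hzV k, haz k, h⟩ hx.2
    -- Passing from `s (φ k)` down to `z k` preserves convergence, since not following is inherited
    -- by initial segments.
    have hz : Conv f z x := by
      refine ⟨n, hn, hzx, fun α => ?_⟩
      filter_upwards [hα α] with k hk hF
      exact hk (hF.mono (hzs k))
    have hxV : x ∈ V := by
      by_contra hxV
      exact hx.2 ⟨x, hxV, hx.1, le_rfl⟩
    obtain ⟨k, hk⟩ := (isOpen_iff.mp hV x hxV z hz).exists
    exact hzV k hk
  · rintro ⟨z, h1, h2, h3⟩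
    exact h1 (le_antisymm h2 h3 ▸ ha)
  · rintro y ⟨h1, h2⟩
    by_contra hy
    exact h2 ⟨y, hy, h1, le_rfl⟩

theorem isZeroDimensional : @IsZeroDimensional FinSeq 𝒯 := by
  let := 𝒯
  refine TopologicalSpace.isTopologicalBasis_of_isOpen_of_nhds (fun U hU => hU.2) ?_
  intro a V ha hV
  obtain ⟨U, h1, h2, h3⟩ := exists_isClopen_subset hV ha
  exact ⟨U, h1, h2, h3⟩

theorem t2Space : @T2Space FinSeq 𝒯 := by
  let := 𝒯
  refine ⟨fun a b hab => ?_⟩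
  by_cases h : a ≤ b
  · have h' : ¬ b ≤ a := fun h' => hab (le_antisymm h h')
    exact ⟨(Ici b)ᶜ, Ici b, (isClopen_Ici b).compl.2, (isClopen_Ici b).2, h', self_mem_Ici,
      disjoint_compl_left⟩
  · exact ⟨Ici a, (Ici a)ᶜ, (isClopen_Ici a).2, (isClopen_Ici a).compl.2, self_mem_Ici, h,
      disjoint_compl_right⟩

/-! ### The Fréchet property -/

/-- The difficulty is to go far enough along each row to avoid `f α`, yet keep the weights small
enough for the remaining `α`. The index `δ` is closed off so that both demands are met. -/
theorem exists_conv_diagonal [LinearOrder I] (hf : IsUnboundedScale f) {a : FinSeq}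
    {x : ℕ → FinSeq} (hx : Conv f x a) {z : ℕ → ℕ → FinSeq} (hxz : ∀ k i, x k ≤ z k i)
    (hz : ∀ k α, ∀ᶠ i in atTop, ¬ Follows (f α) (x k) (z k i)) :
    ∃ φ i : ℕ → ℕ, Conv f (fun j => z (φ j) (i j)) a := by
  obtain ⟨n, hn, hnx, hxα⟩ := hx
  have h1 : ∀ α k, ∃ m, ∀ i ≥ m, ¬ Follows (f α) (x k) (z k i) :=
    fun α k => eventually_atTop.mp (hz k α)
  choose h hh using h1
  -- `ι γ` picks entries far enough out for every `β < γ`; `ν γ` is an index whose function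
  -- infinitely often exceeds their weights.
  choose ι hι using fun γ => hf.bounded_Iio γ h
  choose ν hν using fun γ => hf.exists_lt_comp hn fun k => weight (z k (ι γ k))
  obtain ⟨γ₀, -⟩ := hf.unbounded 0
  let γ : ℕ → I := fun j => Nat.rec γ₀ (fun _ c => max c (ν c)) j
  have hγ : ∀ j, γ (j + 1) = max (γ j) (ν (γ j)) := fun j => rfl
  have hγm : Monotone γ := monotone_nat_of_le_succ fun j => by rw [hγ]; exact le_max_left _ _
  obtain ⟨δ, hδ, hδ'⟩ := hf.exists_isLUB γ
  have hfreq : ∀ j, ∃ᶠ k in atTop, weight (z k (ι (γ j) k)) < f δ (n k) := by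
    intro j
    have hle : ν (γ j) ≤ δ := (le_max_right (γ j) _).trans ((hγ j).ge.trans (hδ (j + 1)))
    refine ((hν (γ j)).and_eventually
      (hn.tendsto_atTop.eventually (hf.eventually_le _ _ hle))).mono ?_
    rintro k ⟨h1, h2⟩
    exact h1.trans_le h2
  have hN : ∀ β j, ∃ N, β < γ j → ∀ k ≥ N, h β k ≤ ι (γ j) k := by
    intro β j
    rcases em (β < γ j) with hβ | hβ
    · obtain ⟨N, hN⟩ := eventually_atTop.mp (hι (γ j) β hβ)
      exact ⟨N, fun _ => hN⟩
    · exact ⟨0, fun h => absurd h hβ⟩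
  choose N hN using hN
  -- `N β j` is where `ι (γ j)` starts to dominate `h β`; one `M` eventually bounds these for all `β
  -- < δ`, so `φ j ≥ M j` suffices.
  obtain ⟨M, hM⟩ := hf.bounded_Iio δ N
  obtain ⟨φ, hφ, hφP⟩ := extraction_forall_of_frequently
    (P := fun j k => weight (z k (ι (γ j) k)) < f δ (n k) ∧ M j ≤ k)
    fun j => (hfreq j).and_eventually (eventually_ge_atTop (M j))
  refine ⟨φ, fun j => ι (γ j) (φ j), n ∘ φ, hn.comp hφ,
    fun j => (hnx _).trans (hxz _ _), fun α => ?_⟩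
  rcases lt_or_ge α δ with hα | hα
  · obtain ⟨j₀, hj₀⟩ := hδ' α hα
    filter_upwards [hφ.tendsto_atTop.eventually (hxα α), hM α hα, eventually_ge_atTop j₀]
      with j h1 h2 h3 hF
    rcases hF.split (hxz _ _) with hF | hF
    · exact h1 hF
    · exact hh α (φ j) _ (hN α j (hj₀.trans_le (hγm h3)) (φ j) (h2.trans (hφP j).2)) hF
  · filter_upwards [(hn.comp hφ).tendsto_atTop.eventually (hf.eventually_le _ _ hα),
      (hn.comp hφ).tendsto_atTop.eventually (eventually_ne_atTop (f α (weight a)))] with j h1 h2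
    exact not_follows_of_weight_lt (hf.monotone α) ((hnx _).trans (hxz _ _)) h2
      ((hφP j).1.trans_le h1)

theorem frechetUrysohnSpace [LinearOrder I] (hf : IsUnboundedScale f) :
    @FrechetUrysohnSpace FinSeq 𝒯 := by
  let := 𝒯
  refine ⟨fun Y => ?_⟩
  -- Avoidance is recorded along with convergence because the diagonal argument needs it of every
  -- row; constant sequences put `Y` inside `Z`.
  let Z : Set FinSeq := {a | ∃ s : ℕ → FinSeq, (∀ k, s k ∈ Y) ∧ (∀ k, a ≤ s k) ∧
    (∀ α, ∀ᶠ k in atTop, ¬ Follows (f α) a (s k)) ∧ Tendsto s atTop (𝓝 a)}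
  have hYZ : Y ⊆ Z := fun a ha => ⟨fun _ => a, fun _ => ha, fun _ => le_rfl,
    fun α => Eventually.of_forall fun _ => not_follows_self _ _, tendsto_const_nhds⟩
  have hZ : IsClosed Z := by
    refine ⟨isOpen_iff.mpr fun a ha s hs => ?_⟩
    by_contra hfr
    obtain ⟨φ, hφ, hφs⟩ := extraction_of_frequently_atTop hfr
    have hmem : ∀ k, s (φ k) ∈ Z := fun k => hφs k
    choose z hzY hle hzα hzt using hmem
    obtain ⟨ψ, i, hc⟩ := exists_conv_diagonal hf (hs.comp hφ) hle hzα
    have hle' := hc.le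
    have ht := hc.tendsto
    obtain ⟨_, _, _, hα⟩ := hc
    exact ha ⟨_, fun j => hzY _ _, hle', hα, ht⟩
  refine (closure_minimal hYZ hZ).trans ?_
  rintro a ⟨s, hs, -, -, ht⟩
  exact ⟨s, hs, ht⟩

/-! ### The `π`-character -/

theorem boundingNumber_le_card_of_isLocalPiBase [LinearOrder I] (hf : IsUnboundedScale f)
    {t : FinSeq} {B : Set (Set FinSeq)} (hB : @IsLocalPiBase FinSeq 𝒯 t B) :
    boundingNumber ≤ #B := by
  let := 𝒯
  by_contra hlt
  rw [not_le] at hlt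
  have hx : ∀ V : B, ∃ x, x ∈ (V : Set FinSeq) := fun V => (hB.1 V V.2).2
  choose x hx using hx
  have hchild : ∀ (V : B) (y : FinSeq), y ∈ (V : Set FinSeq) →
      ∃ N, ∀ q ≥ N, cons q y ∈ (V : Set FinSeq) := fun V y hy =>
    eventually_atTop.mp (isOpen_iff.mp (hB.1 V V.2).1 y hy _ (conv_cons y))
  -- For large `m`, the chosen successor of `x V` has weight exactly `m`, so following `f α` there
  -- means appending `f α m`.
  have hh : ∀ (V : B) (m : ℕ), ∃ N, cons (m - weight (x V) - 1) (x V) ∈ (V : Set FinSeq) →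
      ∀ q ≥ N, cons q (cons (m - weight (x V) - 1) (x V)) ∈ (V : Set FinSeq) := by
    intro V m
    by_cases hm : cons (m - weight (x V) - 1) (x V) ∈ (V : Set FinSeq)
    · obtain ⟨N, hN⟩ := hchild V _ hm
      exact ⟨N, fun _ => hN⟩
    · exact ⟨0, fun h => absurd h hm⟩
  choose h hh using hh
  obtain ⟨g, hg⟩ := exists_dominating_of_lt_boundingNumber h hlt
  obtain ⟨α, hα⟩ := hf.unbounded g
  have hU : Ici t ∩ {y | Follows (f α) t y}ᶜ ∈ 𝓝 t :=
    ((isClopen_Ici t).2.inter (isClopen_follows α t).compl.2).mem_nhds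
      ⟨self_mem_Ici, not_follows_self _ _⟩
  obtain ⟨V, hV, hVU⟩ := hB.2 _ hU
  obtain ⟨N, hN⟩ := hchild ⟨V, hV⟩ _ (hx ⟨V, hV⟩)
  obtain ⟨m, hm1, hm2, hm3⟩ := (hα.and_eventually ((hg ⟨V, hV⟩).and
    (eventually_ge_atTop (N + weight (x ⟨V, hV⟩) + 1)))).exists
  have hmV := hN (m - weight (x ⟨V, hV⟩) - 1) (by omega)
  have hq := hh ⟨V, hV⟩ m hmV (f α m) (hm2.trans hm1.le)
  refine (hVU hq).2 ⟨_, f α m, (hVU hmV).1, le_rfl, ?_⟩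
  rw [weight_cons]
  congr 1
  omega

end FinSeq

/-! ### π-bases in arbitrary spaces -/

theorem isLocalPiBase_setOf_isOpen {X : Type*} [TopologicalSpace X] (x : X) :
    IsLocalPiBase x {V : Set X | IsOpen V ∧ V.Nonempty} := by
  refine ⟨fun V hV => hV, fun U hU => ?_⟩
  obtain ⟨V, hVU, hV, hx⟩ := mem_nhds_iff.mp hU
  exact ⟨V, ⟨hV, x, hx⟩, hVU⟩

theorem IsPiBase.isLocalPiBase {X : Type*} [TopologicalSpace X] {B : Set (Set X)}
    (hB : IsPiBase B) (x : X) : IsLocalPiBase x B := by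
  refine ⟨hB.1, fun U hU => ?_⟩
  obtain ⟨V, hVU, hV, hx⟩ := mem_nhds_iff.mp hU
  obtain ⟨W, hW, hWV⟩ := hB.2 V hV ⟨x, hx⟩
  exact ⟨W, hW, hWV.trans hVU⟩

theorem exists_isLocalPiBase_card_eq {X : Type*} [TopologicalSpace X] (x : X) :
    ∃ B : Set (Set X), IsLocalPiBase x B ∧ #B = piCharacter x :=
  csInf_mem (s := {κ | ∃ B : Set (Set X), IsLocalPiBase x B ∧ #B = κ})
    ⟨_, _, isLocalPiBase_setOf_isOpen x, rfl⟩

theorem exists_isPiBase_card_eq (X : Type*) [TopologicalSpace X] :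
    ∃ B : Set (Set X), IsPiBase B ∧ #B = piWeight X :=
  csInf_mem (s := {κ | ∃ B : Set (Set X), IsPiBase B ∧ #B = κ})
    ⟨_, {V : Set X | IsOpen V ∧ V.Nonempty}, ⟨fun _ hV => hV, fun U hU hne =>
      ⟨U, ⟨hU, hne⟩, Subset.rfl⟩⟩, rfl⟩

/-! ### Nowhere dense sets -/

theorem mem_nwdIdeal {X : Type*} [TopologicalSpace X] {A : Set X} :
    A ∈ nwdIdeal X ↔ IsNowhereDense A := Iff.rfl

theorem not_isNowhereDense_of_subset_closure {X : Type*} [TopologicalSpace X] {U A : Set X}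
    (hU : IsOpen U) (hne : U.Nonempty) (h : U ⊆ closure A) : ¬ IsNowhereDense A := by
  intro hA
  obtain ⟨x, hx⟩ := hne
  have : x ∈ interior (closure A) := interior_maximal h hU hx
  rw [hA] at this
  exact this

theorem nwdIdeal_isProper (X : Type*) [TopologicalSpace X] [Nonempty X] :
    (nwdIdeal X).IsProper :=
  Order.Ideal.isProper_of_notMem (p := univ) fun h =>
    not_isNowhereDense_of_subset_closure isOpen_univ univ_nonempty subset_closure
      (mem_nwdIdeal.mp h)

theorem exists_mem_diff_of_subset_closure {X : Type*} [TopologicalSpace X] {W A O : Set X}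
    (hW : IsOpen W) (hWA : W ⊆ closure A) (hO : IsClosed O) (h : (W \ O).Nonempty) :
    ∃ b ∈ A, b ∉ O := by
  obtain ⟨x, hx⟩ := h
  obtain ⟨b, hb, hbA⟩ := mem_closure_iff.mp (hWA hx.1) _ (hW.sdiff hO) hx
  exact ⟨b, hbA, hb.2⟩

/-- If no countable family is a local `π`-base, countably many somewhere dense sets can be met by
one nowhere dense set. -/
theorem exists_isNowhereDense_inter_nonempty {X : Type*} [TopologicalSpace X] [Countable X]
    [Nonempty X] [T1Space X] (hX : IsZeroDimensional X)
    (hπ : ∀ (x : X) (B : Set (Set X)), B.Countable → ¬ IsLocalPiBase x B)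
    (A : ℕ → Set X) (hA : ∀ n, ¬ IsNowhereDense (A n)) :
    ∃ N : Set X, IsNowhereDense N ∧ ∀ n, (A n ∩ N).Nonempty := by
  let W : ℕ → Set X := fun n => interior (closure (A n))
  have hW : ∀ n, (W n).Nonempty := fun n => nonempty_iff_ne_empty.mpr (hA n)
  obtain ⟨d, hd⟩ := exists_surjective_nat X
  have hstep : ∀ (x : X) (O : {O : Set X // IsClopen O ∧ ∀ n, (W n \ O).Nonempty}),
      ∃ O' : {O : Set X // IsClopen O ∧ ∀ n, (W n \ O).Nonempty}, O.1 ⊆ O'.1 ∧ x ∈ O'.1 := by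
    rintro x ⟨O, hO, hne⟩
    -- These countably many open sets are no local π-base at `x`, so `x` can be absorbed into `O`
    -- without swallowing any of them.
    have hnot := hπ x (range fun n => W n \ O) (countable_range _)
    have hU : ∃ U ∈ 𝓝 x, ∀ n, ¬ W n \ O ⊆ U := by
      by_contra hcon
      push Not at hcon
      refine hnot ⟨?_, fun U hU => ?_⟩
      · rintro _ ⟨n, rfl⟩
        exact ⟨isOpen_interior.sdiff hO.1, hne n⟩
      · obtain ⟨n, hn⟩ := hcon U hU
        exact ⟨_, ⟨n, rfl⟩, hn⟩
    obtain ⟨U, hU, hUn⟩ := hU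
    obtain ⟨V, hV, hxV, hVU⟩ := hX.mem_nhds_iff.mp hU
    refine ⟨⟨O ∪ V, hO.union hV, fun n => ?_⟩, subset_union_left, Or.inr hxV⟩
    obtain ⟨y, hy, hyU⟩ := not_subset.mp (hUn n)
    exact ⟨y, hy.1, fun h => h.elim hy.2 fun h => hyU (hVU h)⟩
  choose S hS hS' using hstep
  let O : ℕ → {O : Set X // IsClopen O ∧ ∀ n, (W n \ O).Nonempty} := fun k =>
    Nat.rec ⟨∅, isClopen_empty, fun n => by simpa using hW n⟩ (fun k o => S (d k) o) k
  have hOm : Monotone fun k => (O k).1 := monotone_nat_of_le_succ fun k => hS (d k) (O k)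
  have hOd : ∀ k, d k ∈ (O (k + 1)).1 := fun k => hS' (d k) (O k)
  have hb : ∀ k, ∃ b ∈ A k, b ∉ (O k).1 := fun k =>
    exists_mem_diff_of_subset_closure isOpen_interior interior_subset (O k).2.1.1 ((O k).2.2 k)
  choose b hbA hbO using hb
  refine ⟨range b, ?_, fun n => ⟨b n, hbA n, n, rfl⟩⟩
  rw [IsNowhereDense, ← not_nonempty_iff_eq_empty]
  rintro ⟨x, hx⟩
  obtain ⟨k, rfl⟩ := hd x
  let G := interior (closure (range b)) ∩ (O (k + 1)).1
  have hG : IsOpen G := isOpen_interior.inter (O (k + 1)).2.1.2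
  have hfin : (range b ∩ (O (k + 1)).1).Finite := by
    refine ((finite_Iio (k + 1)).image b).subset ?_
    rintro _ ⟨⟨j, rfl⟩, hj⟩
    refine ⟨j, ?_, rfl⟩
    by_contra hjk
    exact hbO j (hOm (not_lt.mp hjk) hj)
  -- Only finitely many `b j` lie in the clopen set `O (k + 1)`, so an interior point there would be
  -- isolated, which already yields a countable local π-base.
  have hGfin : G.Finite := by
    refine hfin.subset ?_
    rw [← hfin.isClosed.closure_eq]
    rintro y ⟨hy, hyO⟩
    rw [mem_closure_iff]
    intro V hV hyV
    obtain ⟨c, hc, hcb⟩ := mem_closure_iff.mp (interior_subset hy) _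
      (hV.inter (O (k + 1)).2.1.2) ⟨hyV, hyO⟩
    exact ⟨c, hc.1, hcb, hc.2⟩
  have hsing : IsOpen {d k} := by
    have heq : {d k} = G \ (G \ {d k}) := by
      rw [sdiff_sdiff_cancel_left]
      exact singleton_subset_iff.mpr ⟨hx, hOd k⟩
    rw [heq]
    exact hG.sdiff (hGfin.subset sdiff_subset).isClosed
  refine hπ (d k) {{d k}} (countable_singleton _) ⟨?_, fun U hU => ?_⟩
  · rintro _ rfl
    exact ⟨hsing, singleton_nonempty _⟩
  · exact ⟨_, rfl, singleton_subset_iff.mpr (mem_of_mem_nhds hU)⟩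

/-- Under a reduction, images of basic open sets are somewhere dense. A nowhere dense set meeting
all of them has dense preimage in ℚ. -/
theorem not_katetovLE_nwdIdeal_rat {X : Type*} [TopologicalSpace X] [Countable X] [Nonempty X]
    [T1Space X] (hX : IsZeroDimensional X)
    (hπ : ∀ (x : X) (B : Set (Set X)), B.Countable → ¬ IsLocalPiBase x B) :
    ¬ KatetovLE (nwdIdeal X) (nwdIdeal ℚ) := by
  rintro ⟨f, hf⟩
  obtain ⟨b, hbc, hbne, hb⟩ := TopologicalSpace.exists_countable_basis ℚ
  have hbN : b.Nonempty := by
    obtain ⟨V, hV, -⟩ := hb.exists_subset_of_mem_open (mem_univ (0 : ℚ)) isOpen_univ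
    exact ⟨V, hV⟩
  obtain ⟨V, rfl⟩ := hbc.exists_eq_range hbN
  have hVo : ∀ n, IsOpen (V n) := fun n => hb.isOpen ⟨n, rfl⟩
  have hVne : ∀ n, (V n).Nonempty := fun n => by
    rw [nonempty_iff_ne_empty]
    exact fun h => hbne ⟨n, h⟩
  obtain ⟨N, hN, hVN⟩ := exists_isNowhereDense_inter_nonempty hX hπ (fun n => f '' V n)
    fun n h => not_isNowhereDense_of_subset_closure (hVo n) (hVne n)
      ((subset_preimage_image f _).trans subset_closure) (mem_nwdIdeal.mp (hf _ h))
  refine not_isNowhereDense_of_subset_closure isOpen_univ univ_nonempty ?_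
    (mem_nwdIdeal.mp (hf N hN))
  intro x _
  rw [hb.mem_closure_iff]
  rintro _ ⟨n, rfl⟩ -
  obtain ⟨_, ⟨q, hq, rfl⟩, hqN⟩ := hVN n
  exact ⟨q, hq, hqN⟩

/-! ### The ideal `ED` -/

theorem column_mem_idealED (n : ℕ) : {p : ℕ × ℕ | p.1 = n} ∈ idealED :=
  ⟨{{p | p.1 = n}}, finite_singleton _, singleton_subset_iff.mpr (Or.inl ⟨n, rfl⟩),
    by rw [sUnion_singleton]⟩

theorem graph_mem_idealED (F : ℕ → ℕ) : {p : ℕ × ℕ | p.2 = F p.1} ∈ idealED :=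
  ⟨{{p | p.2 = F p.1}}, finite_singleton _, singleton_subset_iff.mpr (Or.inr ⟨F, rfl⟩),
    by rw [sUnion_singleton]⟩

theorem range_mem_idealED {p : ℕ → ℕ × ℕ} (hp : StrictMono fun m => (p m).1) :
    range p ∈ idealED := by
  refine idealED.lower ?_ (graph_mem_idealED fun c => (p (Function.invFun (fun m => (p m).1) c)).2)
  rintro _ ⟨m, rfl⟩
  have := Function.leftInverse_invFun hp.injective m
  exact congrArg (fun i => (p i).2) this.symm

theorem subset_closure_diff_of_isNowhereDense {X : Type*} [TopologicalSpace X] {U Y M : Set X}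
    (hU : IsOpen U) (hUY : U ⊆ closure Y) (hM : IsNowhereDense M) : U ⊆ closure (Y \ M) := by
  intro x hx
  by_contra hxc
  refine not_isNowhereDense_of_subset_closure (hU.sdiff (isClosed_closure (s := Y \ M)))
    ⟨x, hx, hxc⟩ ?_ hM
  rintro y ⟨hy, hyc⟩
  have h : y ∈ closure (Y \ M ∪ M) := closure_mono (by intro z hz; by_cases h : z ∈ M <;> simp [*])
    (hUY hy)
  rw [closure_union] at h
  exact h.resolve_left hyc

theorem not_katetovLE_idealED {X : Type*} [TopologicalSpace X] [Countable X] [T2Space X]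
    [FrechetUrysohnSpace X] (hX : ∀ x : X, ¬ IsOpen {x}) {Y : Set X} (hY : Y ∉ nwdIdeal X) :
    ¬ KatetovLE idealED (restrictIdeal (nwdIdeal X) Y) := by
  rintro ⟨g, hg⟩
  have hg' : ∀ A ∈ idealED, IsNowhereDense (((↑) : Y → X) '' (g ⁻¹' A)) := hg
  let U := interior (closure Y)
  have hU : IsOpen U := isOpen_interior
  have hUne : U.Nonempty := nonempty_iff_ne_empty.mpr hY
  let L : ℕ → Set X := fun n => ((↑) : Y → X) '' {y | n ≤ (g y).1}
  have hlow : ∀ n, {p : ℕ × ℕ | p.1 < n} ∈ idealED := by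
    intro n
    induction n with
    | zero => exact idealED.lower (by intro p hp; simp at hp) (column_mem_idealED 0)
    | succ n ih =>
      refine idealED.lower ?_ (Order.Ideal.sup_mem ih (column_mem_idealED n))
      intro p hp
      exact Nat.lt_succ_iff_lt_or_eq.mp hp
  have hUL : ∀ n, U ⊆ closure (L n) := by
    intro n
    refine (subset_closure_diff_of_isNowhereDense hU interior_subset (hg' _ (hlow n))).trans
      (closure_mono ?_)
    rintro y ⟨hy, hyn⟩
    refine ⟨⟨y, hy⟩, ?_, rfl⟩
    by_contra hlt
    have h' : (g ⟨y, hy⟩).1 < n := lt_of_not_ge hlt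
    exact hyn ⟨⟨y, hy⟩, h', rfl⟩
  have hseq : ∀ u : U, ∃ s : ℕ → Y, Tendsto (fun k => (s k : X)) atTop (𝓝 (u : X)) ∧
      Tendsto (fun k => (g (s k)).1) atTop atTop := by
    rintro ⟨u, hu⟩
    have h1 : u ∈ closure (U \ {u}) := by
      by_contra hcl
      obtain ⟨O, hO, huO, hdisj⟩ : ∃ O, IsOpen O ∧ u ∈ O ∧ ¬ (O ∩ (U \ {u})).Nonempty := by
        rw [mem_closure_iff] at hcl
        push Not at hcl
        obtain ⟨O, h1, h2, h3⟩ := hcl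
        exact ⟨O, h1, h2, not_nonempty_iff_eq_empty.mpr h3⟩
      refine hX u ?_
      have : {u} = O ∩ U := by
        refine Subset.antisymm (singleton_subset_iff.mpr ⟨huO, hu⟩) fun y hy => ?_
        by_contra hyu
        exact hdisj ⟨y, hy.1, hy.2, hyu⟩
      rw [this]
      exact hO.inter hU
    obtain ⟨y, hyU, hyu⟩ := mem_closure_iff_seq_limit.mp h1
    -- The closures of the `V n` miss `u`, so a sequence from `⋃ n, V n ∩ L n` converging to `u`
    -- leaves each `V n`, which drives the first coordinates to infinity.
    have hV : ∀ n, ∃ V, IsOpen V ∧ y n ∈ V ∧ u ∉ closure V := by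
      intro n
      obtain ⟨V, V', hV, hV', hyV, huV', hd⟩ := t2_separation (hyU n).2
      refine ⟨V, hV, hyV, fun hcl => ?_⟩
      obtain ⟨w, hw, hw'⟩ := mem_closure_iff.mp hcl V' hV' huV'
      exact hd.le_bot ⟨hw', hw⟩
    choose V hVo hyV huV using hV
    have h2 : u ∈ closure (⋃ n, V n ∩ L n) := by
      rw [mem_closure_iff]
      intro O hO huO
      obtain ⟨n, hn⟩ := (hyu.eventually (hO.mem_nhds huO)).exists
      obtain ⟨w, hw, hwL⟩ := mem_closure_iff.mp (hUL n (hyU n).1) _ (hO.inter (hVo n)) ⟨hn, hyV n⟩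
      exact ⟨w, hw.1, mem_iUnion.mpr ⟨n, hw.2, hwL⟩⟩
    obtain ⟨z, hz, hzu⟩ := mem_closure_iff_seq_limit.mp h2
    have hz' : ∀ k, ∃ n, ∃ s : Y, z k ∈ V n ∧ n ≤ (g s).1 ∧ (s : X) = z k := by
      intro k
      obtain ⟨n, hn, s, hs, hsz⟩ := mem_iUnion.mp (hz k)
      exact ⟨n, s, hn, hs, hsz⟩
    choose n s hzV hns hsz using hz'
    refine ⟨s, by simpa only [hsz] using hzu, tendsto_atTop.mpr fun m => ?_⟩
    have hev : ∀ᶠ k in atTop, ∀ i ∈ Finset.range m, z k ∉ V i := by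
      rw [eventually_all_finset]
      intro i _
      filter_upwards [hzu.eventually (isClosed_closure.isOpen_compl.mem_nhds (huV i))] with k hk
      exact fun h => hk (subset_closure h)
    filter_upwards [hev] with k hk
    by_contra hlt
    have : n k < m := (hns k).trans_lt (not_le.mp hlt)
    exact hk (n k) (Finset.mem_range.mpr this) (hzV k)
  choose s hs hsg using hseq
  have : Nonempty U := hUne.to_subtype
  obtain ⟨e, he⟩ := exists_surjective_nat U
  have hK : ∀ m c : ℕ, ∃ k, m ≤ k ∧ c < (g (s (e m.unpair.1) k)).1 := fun m c =>
    ((eventually_ge_atTop m).and ((hsg (e m.unpair.1)).eventually (eventually_gt_atTop c))).exists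
  choose K hKm hKc using hK
  -- Unpairing `m` visits every `u` infinitely often, ever further along its sequence; `c` carries
  -- the last first coordinate used, so the points chosen lie on one graph and are dense in `U`.
  let c : ℕ → ℕ := fun m => Nat.rec 0 (fun m c => (g (s (e m.unpair.1) (K m c))).1) m
  let p : ℕ → Y := fun m => s (e m.unpair.1) (K m (c m))
  have hc : ∀ m, c (m + 1) = (g (p m)).1 := fun m => rfl
  have hcm : StrictMono c := strictMono_nat_of_lt_succ fun m => hKc m (c m)
  have hp : StrictMono fun m => (g (p m)).1 := fun a b hab => by
    simp only [← hc]
    exact hcm (Nat.succ_lt_succ hab)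
  refine not_isNowhereDense_of_subset_closure hU hUne ?_ (hg' _ (range_mem_idealED hp))
  intro u hu
  obtain ⟨i, hi⟩ := he ⟨u, hu⟩
  rw [mem_closure_iff]
  intro O hO huO
  have := (hs (e i)).eventually (hO.mem_nhds (by rw [hi]; exact huO))
  obtain ⟨k₀, hk₀⟩ := eventually_atTop.mp this
  let m := Nat.pair i k₀
  have hm : m.unpair.1 = i := by simp [m]
  refine ⟨p m, ?_, p m, ⟨m, rfl⟩, rfl⟩
  have hpm : p m = s (e i) (K m (c m)) := by simp only [p, hm]
  rw [hpm]
  exact hk₀ _ ((Nat.right_le_pair i k₀).trans (hKm m (c m)))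

/-! ### Copies of ideals -/

theorem not_categoryDichotomy_pushIdeal {X Y : Type*} (e : X ≃ Y) {I : Order.Ideal (Set X)}
    (hI : ¬ CategoryDichotomy I) : ¬ CategoryDichotomy (pushIdeal e I) := by
  rintro (⟨f, hf⟩ | ⟨Z, hZ, g, hg⟩)
  · refine hI (Or.inl ⟨e.symm ∘ f, fun A hA => ?_⟩)
    rw [preimage_comp]
    refine hf _ ?_
    change e ⁻¹' (e.symm ⁻¹' A) ∈ I
    rwa [← preimage_comp, e.symm_comp_self, preimage_id]
  · refine hI (Or.inr ⟨e ⁻¹' Z, hZ, fun x => g ⟨e x, x.2⟩, fun A hA => ?_⟩)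
    have h : e ⁻¹' (((↑) : Z → Y) '' (g ⁻¹' A)) ∈ I := hg A hA
    refine I.lower ?_ h
    rintro _ ⟨x, hx, rfl⟩
    exact ⟨⟨e x, x.2⟩, hx, rfl⟩

theorem pushIdeal_isProper {X Y : Type*} (e : X → Y) {I : Order.Ideal (Set X)} (hI : I.IsProper) :
    (pushIdeal e I).IsProper :=
  Order.Ideal.isProper_of_notMem (p := univ) fun h => hI.ne_univ <| eq_univ_of_forall fun A =>
    I.lower (subset_univ A) (show e ⁻¹' univ ∈ I from h)

/-! ### Assembly of the theorem -/

theorem mainTheorem1 :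
    ∃ τ : TopologicalSpace FinSeq,
      T2Space FinSeq ∧ FrechetUrysohnSpace FinSeq ∧ IsZeroDimensional FinSeq ∧
      boundingNumber ≤ piWeight FinSeq ∧
      (∀ x : FinSeq, ℵ₀ < piCharacter x) ∧
      (nwdIdeal FinSeq).IsProper ∧
      ¬ KatetovLE (nwdIdeal FinSeq) (nwdIdeal ℚ) ∧
      (∀ Y : Set FinSeq, Y ∉ nwdIdeal FinSeq →
        ¬ KatetovLE idealED (restrictIdeal (nwdIdeal FinSeq) Y)) ∧
      ¬ CategoryDichotomy (nwdIdeal FinSeq) ∧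
      (∀ e : FinSeq ≃ ℕ, (pushIdeal e (nwdIdeal FinSeq)).IsProper ∧
        ¬ CategoryDichotomy (pushIdeal e (nwdIdeal FinSeq))) := by
  obtain ⟨I, _, f, hf⟩ := exists_isUnboundedScale
  let _ := FinSeq.convTopology f
  have hT2 : T2Space FinSeq := FinSeq.t2Space
  have hFU : FrechetUrysohnSpace FinSeq := FinSeq.frechetUrysohnSpace hf
  have hzero : IsZeroDimensional FinSeq := FinSeq.isZeroDimensional
  have hcard : ∀ (x : FinSeq) (B : Set (Set FinSeq)), IsLocalPiBase x B → boundingNumber ≤ #B :=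
    fun x B hB => FinSeq.boundingNumber_le_card_of_isLocalPiBase hf hB
  have hπ : ∀ (x : FinSeq) (B : Set (Set FinSeq)), B.Countable → ¬ IsLocalPiBase x B :=
    fun x B hBc hB => absurd (le_aleph0_iff_set_countable.mpr hBc)
      (not_le.mpr (aleph0_lt_boundingNumber.trans_le (hcard x B hB)))
  have hiso : ∀ x : FinSeq, ¬ IsOpen {x} := fun x hx => by
    refine hπ x {{x}} (countable_singleton _) ⟨?_, fun U hU => ?_⟩
    · rintro _ rfl
      exact ⟨hx, singleton_nonempty _⟩
    · exact ⟨_, rfl, singleton_subset_iff.mpr (mem_of_mem_nhds hU)⟩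
  have hQ := not_katetovLE_nwdIdeal_rat hzero hπ
  have hED : ∀ Y : Set FinSeq, Y ∉ nwdIdeal FinSeq →
      ¬ KatetovLE idealED (restrictIdeal (nwdIdeal FinSeq) Y) :=
    fun Y hY => not_katetovLE_idealED hiso hY
  have hCD : ¬ CategoryDichotomy (nwdIdeal FinSeq) := by
    rintro (h | ⟨Y, hY, h⟩)
    · exact hQ h
    · exact hED Y hY h
  refine ⟨_, hT2, hFU, hzero, ?_, fun x => ?_, nwdIdeal_isProper _, hQ, hED, hCD, fun e =>
    ⟨pushIdeal_isProper e (nwdIdeal_isProper _), not_categoryDichotomy_pushIdeal e hCD⟩⟩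
  · obtain ⟨B, hB, hBc⟩ := exists_isPiBase_card_eq FinSeq
    rw [← hBc]
    exact hcard (Classical.arbitrary FinSeq) B (hB.isLocalPiBase _)
  · obtain ⟨B, hB, hBc⟩ := exists_isLocalPiBase_card_eq x
    rw [← hBc]
    exact aleph0_lt_boundingNumber.trans_le (hcard x B hB)
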